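/- Let $p$ be a prime number and let $\varphi : A \to R$ be a homomorphism of Noetherian commutative rings of characteristic $p$, where $A$ is a domain with fraction field $K$. Let $F_*A$ denote the ring $A$ regarded as an $A$-algebra via the Frobenius $a \mapsto a^p$, let $F_*R$ denote the ring $R$ regarded as an $R$-algebra via its Frobenius, and let $$F_{R/A} : F_*A \otimes_A R \to F_*R, \qquad a \otimes r \mapsto \varphi(a)\, r^p,$$ be the relative Frobenius. For a field $k$, a $k$-algebra $S$ is called geometrically reduced over $k$ if $k' \otimes_k S$ is reduced for every field extension $k'/k$ (equivalently, if $\overline{k} \otimes_k S$ is reduced for an algebraic closure $\overline{k}$ of $k$). Consider the following statements: 1. $F_{R/A}$ is injective. 2. The generic fiber $R_K = K \otimes_A R$ is geometrically reduced over $K$. 3. There exists a nonzero $f \in A$ such that the induced map $\varphi_f : A_f \to R_f$ is flat and has geometrically reduced fibers, that is, for every prime $\mathfrak q$ of $A_f$ with residue field $\kappa(\mathfrak q)$, the ring $\kappa(\mathfrak q) \otimes_{A_f} R_f$ is geometrically reduced over $\kappa(\mathfrak q)$. Then (1) $\Leftrightarrow$ (2) if $\varphi$ is flat, and (2) $\Leftrightarrow$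 (3) if $\varphi$ is of finite type (not necessarily flat). -/

import Mathlib

open scoped TensorProduct

noncomputable section

/-- `F_* S`: the ring `S`, regarded as an algebra over `S` (and over every base of `S`) through the
Frobenius `s ↦ s ^ p`. -/
def FrobeniusPushforward (_p : ℕ) (S : Type*) : Type _ := S

namespace FrobeniusPushforward

variable (p : ℕ) (A R S : Type*) [CommRing A] [CommRing R] [CommRing S] [Algebra A R]

instance : CommRing (FrobeniusPushforward p S) := inferInstanceAs (CommRing S)

/-- The identity of rings `S → F_* S` (not linear over `S`). -/
def of : S ≃+* FrobeniusPushforward p S := RingEquiv.refl S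

/-- `a : A` acts on `F_* R` as multiplication by `φ(a) ^ p`. For `R = A` this is the
`A`-algebra structure of `F_* A`. -/
instance [ExpChar R p] : Algebra A (FrobeniusPushforward p R) :=
  ((of p R : R →+* FrobeniusPushforward p R).comp
    ((frobenius R p).comp (algebraMap A R))).toAlgebra

lemma algebraMap_apply [ExpChar R p] (a : A) :
    algebraMap A (FrobeniusPushforward p R) a = of p R (algebraMap A R a ^ p) := rfl

/-- `F_* φ : F_* A → F_* R`, which is `φ` on underlying rings. -/
def map [ExpChar A p] [ExpChar R p] :
    FrobeniusPushforward p A →ₐ[A] FrobeniusPushforward p R where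
  __ := ((of p R : R →+* FrobeniusPushforward p R).comp (algebraMap A R)).comp
    ((of p A).symm : FrobeniusPushforward p A →+* A)
  commutes' a := map_pow (algebraMap A R) a p

/-- The absolute Frobenius `R → F_* R`, `r ↦ r ^ p`. -/
def frob [ExpChar R p] : R →ₐ[A] FrobeniusPushforward p R where
  __ := (of p R : R →+* FrobeniusPushforward p R).comp (frobenius R p)
  commutes' _ := rfl

end FrobeniusPushforward

/-- The relative Frobenius `F_{R/A} : F_* A ⊗[A] R → F_* R`, `a ⊗ r ↦ φ(a) * r ^ p`. -/
def relativeFrobenius (p : ℕ) (A R : Type*) [CommRing A] [CommRing R] [Algebra A R]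
    [ExpChar A p] [ExpChar R p] :
    FrobeniusPushforward p A ⊗[A] R →ₐ[A] FrobeniusPushforward p R :=
  Algebra.TensorProduct.productMap (FrobeniusPushforward.map p A R)
    (FrobeniusPushforward.frob p A R)

lemma relativeFrobenius_tmul (p : ℕ) (A R : Type*) [CommRing A] [CommRing R] [Algebra A R]
    [ExpChar A p] [ExpChar R p] (a : A) (r : R) :
    relativeFrobenius p A R (FrobeniusPushforward.of p A a ⊗ₜ[A] r) =
      FrobeniusPushforward.of p R (algebraMap A R a * r ^ p) := by
  rw [relativeFrobenius, Algebra.TensorProduct.productMap_apply_tmul]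
  rfl

/-- Every fiber `κ(q) ⊗ S` of `φ : B → S` is geometrically reduced over the residue field `κ(q)`. -/
def HasGeometricallyReducedFibers {B S : Type*} [CommRing B] [CommRing S] (φ : B →+* S) : Prop :=
  letI := φ.toAlgebra
  ∀ (q : Ideal B) [q.IsPrime], Algebra.IsGeometricallyReduced q.ResidueField (q.Fiber S)

end

-- Let `L` be a perfect field over `A`. Since `L ≃ F_* L`, the Frobenius of `L ⊗[A] R` factors
-- through the base change of `F_{R/A}` from `F_* A` to `F_* L`, so `L ⊗[A] R` is reduced as soon as
-- that base change is injective (`isReduced_tensorProduct_of_injective_lTensor`). Conversely, if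
-- `R` is flat and `A ⊆ L`, then `p`-th roots embed `F_* A ⊗[A] R` in `L ⊗[A] R`, and an element of
-- the kernel of `F_{R/A}` becomes nilpotent there (`injective_relativeFrobenius_of_isReduced`).
-- With `L` an algebraic closure of `K`, which is flat over `A`, this gives (1) ⇔ (2).
--
-- For (2) ⇒ (3), generic flatness first makes `R` flat. Then `F_{R/A}` is injective, and its
-- cokernel is a finite module over a finite type `F_* A`-algebra, hence generically flat as well.
-- Where the cokernel is flat, injectivity survives base change to every `F_* L`, so all geometric
-- fibers there are reduced. For (3) ⇒ (2), the fiber over the zero ideal of `A_f` suffices.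

universe u v

/-! ### Generic flatness by dévissage -/

section GenericFlatness

open LinearMap

theorem Module.Flat.of_exact {A M₁ M₂ M₃ : Type*} [CommRing A] [AddCommGroup M₁] [AddCommGroup M₂]
    [AddCommGroup M₃] [Module A M₁] [Module A M₂] [Module A M₃] {f : M₁ →ₗ[A] M₂}
    {g : M₂ →ₗ[A] M₃} (hf : Function.Injective f) (hfg : Function.Exact f g)
    (hg : Function.Surjective g) [Module.Flat A M₁] [Module.Flat A M₃] : Module.Flat A M₂ := by
  rw [Module.Flat.iff_rTensor_injective']
  intro I
  rw [injective_iff_map_eq_zero]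
  intro x hx
  have h3 : g.lTensor I x = 0 := by
    apply Module.Flat.rTensor_preserves_injective_linearMap (M := M₃) I.subtype I.subtype_injective
    rw [map_zero, ← LinearMap.comp_apply, rTensor_comp_lTensor, ← lTensor_comp_rTensor,
      LinearMap.comp_apply, hx, map_zero]
  obtain ⟨y, rfl⟩ := (_root_.lTensor_exact I hfg hg x).mp h3
  have h1 : I.subtype.rTensor M₁ y = 0 := by
    apply Module.Flat.lTensor_preserves_injective_linearMap (M := A) f hf
    rw [map_zero, ← LinearMap.comp_apply, lTensor_comp_rTensor, ← rTensor_comp_lTensor,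
      LinearMap.comp_apply, hx]
  rw [(injective_iff_map_eq_zero _).mp
    (Module.Flat.rTensor_preserves_injective_linearMap (M := M₁) I.subtype I.subtype_injective) y h1,
    map_zero]

theorem Submodule.FG.exists_le_of_monotone {A M : Type*} [CommRing A] [AddCommGroup M] [Module A M]
    {P : Submodule A M} (hP : P.FG) (N : ℕ → Submodule A M) (hN : Monotone N)
    (h : ∀ x ∈ P, ∃ j, x ∈ N j) : ∃ j, P ≤ N j := by
  obtain ⟨s, rfl⟩ := hP
  have : ∀ x : s, ∃ j, (x : M) ∈ N j := fun x ↦ h x (Submodule.subset_span x.2)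
  choose j hj using this
  refine ⟨Finset.univ.sup j, Submodule.span_le.mpr fun x hx ↦ ?_⟩
  exact hN (Finset.le_sup (Finset.mem_univ ⟨x, hx⟩)) (hj ⟨x, hx⟩)

theorem Module.Flat.of_monotone_exhaustive {A M : Type*} [CommRing A] [AddCommGroup M] [Module A M]
    (N : ℕ → Submodule A M) (hN : Monotone N) (h : ∀ x, ∃ j, x ∈ N j)
    [∀ j, Module.Flat A (N j)] : Module.Flat A M := by
  rw [Module.Flat.iff_rTensor_injective']
  intro I
  rw [injective_iff_map_eq_zero]
  intro x hx
  obtain ⟨P, hP, hxP⟩ := TensorProduct.exists_finite_submodule_right_of_setFinite {x} (by simp)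
  obtain ⟨j, hj⟩ := (Module.Finite.iff_fg.mp hP).exists_le_of_monotone N hN fun x _ ↦ h x
  obtain ⟨y, rfl⟩ := hxP rfl
  have key : P.subtype.lTensor I y =
      (N j).subtype.lTensor I ((Submodule.inclusion hj).lTensor I y) := by
    rw [← LinearMap.comp_apply, ← lTensor_comp]; rfl
  rw [key] at hx ⊢
  have h1 : I.subtype.rTensor (N j) ((Submodule.inclusion hj).lTensor I y) = 0 := by
    apply Module.Flat.lTensor_preserves_injective_linearMap (M := A) (N j).subtype
      (N j).subtype_injective
    rw [map_zero, ← LinearMap.comp_apply, lTensor_comp_rTensor, ← rTensor_comp_lTensor,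
      LinearMap.comp_apply, hx]
  rw [(injective_iff_map_eq_zero _).mp
    (Module.Flat.rTensor_preserves_injective_linearMap (M := N j) I.subtype I.subtype_injective) _
    h1, map_zero]

/-- Flatness passes up the filtration by extensions and then to the increasing union. Flatness of
`T` keeps each `T ⊗[A] N j` inside `T ⊗[A] M`. -/
theorem Module.Flat.tensorProduct_of_filtration {A T M : Type*} [CommRing A] [AddCommGroup T]
    [Module A T] [Module.Flat A T] [AddCommGroup M] [Module A M] (N : ℕ → Submodule A M)
    (hN : Monotone N) (h0 : N 0 = ⊥) (h : ∀ x, ∃ j, x ∈ N j)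
    (hflat : ∀ j, Module.Flat A (T ⊗[A] (N (j + 1) ⧸ (N j).submoduleOf (N (j + 1))))) :
    Module.Flat A (T ⊗[A] M) := by
  have hTN : ∀ j, Module.Flat A (T ⊗[A] N j) := by
    intro j
    induction j with
    | zero =>
      rw [h0]
      exact Module.Flat.of_projective
    | succ j ih =>
      have hle : N j ≤ N (j + 1) := hN j.le_succ
      have hex : Function.Exact (Submodule.inclusion hle)
          ((N j).submoduleOf (N (j + 1))).mkQ := by
        rw [LinearMap.exact_iff, Submodule.ker_mkQ, Submodule.range_inclusion]
        rfl
      exact Module.Flat.of_exact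
        (Module.Flat.lTensor_preserves_injective_linearMap (M := T) _
          (Submodule.inclusion_injective hle))
        (_root_.lTensor_exact T hex (Submodule.mkQ_surjective _))
        (LinearMap.lTensor_surjective T (Submodule.mkQ_surjective _))
  have hflat' (j) : Module.Flat A (LinearMap.range ((N j).subtype.lTensor T)) :=
    Module.Flat.of_linearEquiv (LinearEquiv.ofInjective _
      (Module.Flat.lTensor_preserves_injective_linearMap (M := T) (N j).subtype
        (N j).subtype_injective)).symm
  have hmono : Monotone fun j ↦ LinearMap.range ((N j).subtype.lTensor T) := by
    intro i j hij
    have : (N i).subtype = (N j).subtype ∘ₗ Submodule.inclusion (hN hij) := rfl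
    simp only [this, lTensor_comp]
    exact LinearMap.range_comp_le_range _ _
  refine Module.Flat.of_monotone_exhaustive _ hmono fun x ↦ ?_
  induction x with
  | zero => exact ⟨0, zero_mem _⟩
  | tmul t m =>
    obtain ⟨j, hj⟩ := h m
    exact ⟨j, t ⊗ₜ ⟨m, hj⟩, rfl⟩
  | add x y hx hy =>
    obtain ⟨i, hi⟩ := hx
    obtain ⟨j, hj⟩ := hy
    exact ⟨max i j, add_mem (hmono (le_max_left i j) hi) (hmono (le_max_right i j) hj)⟩

/-- `M` becomes flat over `A` after inverting some nonzero element of `A`. -/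
def IsGenericallyFlat (A : Type u) (M : Type v) [CommRing A] [AddCommGroup M] [Module A M] : Prop :=
  ∃ f : A, f ≠ 0 ∧ ∀ (T : Type u) [CommRing T] [Algebra A T] [Module.Flat A T],
    IsUnit (algebraMap A T f) → Module.Flat A (T ⊗[A] M)

theorem IsGenericallyFlat.of_finite (A : Type u) (M : Type v) [CommRing A] [IsDomain A]
    [IsNoetherianRing A] [AddCommGroup M] [Module A M] [Module.Finite A M] :
    IsGenericallyFlat A M := by
  have : Module.FinitePresentation A M := Module.finitePresentation_of_finite A M
  obtain ⟨f, hf, hfree, -⟩ := Module.FinitePresentation.exists_free_localizedModule_powers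
    (nonZeroDivisors A) (TensorProduct.mk A (FractionRing A) M 1) (FractionRing A)
  refine ⟨f, nonZeroDivisors.ne_zero hf, fun T _ _ _ hu ↦ ?_⟩
  let Af := Localization.Away f
  let : Algebra Af T := (IsLocalization.Away.lift (S := Af) f hu).toAlgebra
  have : IsScalarTower A Af T := .of_algebraMap_eq fun a ↦
    (IsLocalization.Away.lift_eq (S := Af) f hu a).symm
  have e : LocalizedModule.Away f M ≃ₗ[Af] Af ⊗[A] M :=
    IsLocalizedModule.isBaseChange (.powers f) Af (LocalizedModule.mkLinearMap (.powers f) M)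
      |>.equiv.symm
  have : Module.Free Af (Af ⊗[A] M) := .of_equiv e
  have : Module.Flat T (T ⊗[A] M) :=
    Module.Flat.of_linearEquiv (TensorProduct.AlgebraTensorModule.cancelBaseChange A Af T T M).symm
  exact Module.Flat.trans A T _

theorem IsGenericallyFlat.of_linearEquiv {A : Type u} {M N : Type*} [CommRing A] [AddCommGroup M]
    [Module A M] [AddCommGroup N] [Module A N] (e : M ≃ₗ[A] N) (h : IsGenericallyFlat A M) :
    IsGenericallyFlat A N := by
  obtain ⟨f, hf, H⟩ := h
  refine ⟨f, hf, fun T _ _ _ hu ↦ ?_⟩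
  have := H T hu
  exact Module.Flat.of_linearEquiv (e.lTensor T).symm

/-- Every finite `A'`-module is generically flat over `A`. -/
def HasGenericFlatness (A : Type u) (A' : Type*) [CommRing A] [CommRing A'] [Algebra A A'] : Prop :=
  ∀ (M : Type v) [AddCommGroup M] [Module A M] [Module A' M] [IsScalarTower A A' M]
    [Module.Finite A' M], IsGenericallyFlat A M

section

variable {A : Type u} {A' M : Type*} [CommRing A] [CommRing A'] [Algebra A A']
  [AddCommGroup M] [Module A' M]

/-- `∑_{i < n} φ ^ i M₀` -/
def Module.End.powSum (φ : Module.End A' M) (M₀ : Submodule A' M) : ℕ → Submodule A' M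
  | 0 => ⊥
  | n + 1 => powSum φ M₀ n ⊔ M₀.map (φ ^ n)

theorem Module.End.powSum_monotone (φ : Module.End A' M) (M₀ : Submodule A' M) :
    Monotone (φ.powSum M₀) :=
  monotone_nat_of_le_succ fun _ ↦ le_sup_left

theorem Module.End.map_powSum_le (φ : Module.End A' M) (M₀ : Submodule A' M) (n : ℕ) :
    (φ.powSum M₀ n).map φ ≤ φ.powSum M₀ (n + 1) := by
  induction n with
  | zero => simp [powSum]
  | succ n ih =>
    conv_lhs => rw [powSum]
    rw [Submodule.map_sup, ← Submodule.map_comp]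
    refine sup_le (ih.trans (powSum_monotone φ M₀ (n + 1).le_succ)) ?_
    rw [powSum, ← Module.End.mul_eq_comp, ← pow_succ']
    exact le_sup_right

theorem Module.End.exists_mem_powSum (φ : Module.End A' M) (M₀ : Submodule A' M)
    (h : ∀ N : Submodule A' M, M₀ ≤ N → N.map φ ≤ N → N = ⊤) (x : M) :
    ∃ n, x ∈ φ.powSum M₀ n := by
  have htop : ⨆ n, φ.powSum M₀ n = ⊤ := by
    refine h _ (le_trans ?_ (le_iSup _ 1)) ?_
    · simp [powSum, Module.End.one_eq_id]
    · rw [Submodule.map_iSup]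
      exact iSup_le fun n ↦ (map_powSum_le φ M₀ n).trans (le_iSup _ (n + 1))
  exact (Submodule.mem_iSup_of_directed _ (powSum_monotone φ M₀).directed_le).mp
    (htop ▸ Submodule.mem_top)

/-- The elements of `M₀` which `φ ^ n` sends to `∑_{i < n} φ ^ i M₀`. -/
def Module.End.powKer (φ : Module.End A' M) (M₀ : Submodule A' M) (n : ℕ) : Submodule A' M₀ :=
  (φ.powSum M₀ n).comap ((φ ^ n) ∘ₗ M₀.subtype)

theorem Module.End.powKer_monotone (φ : Module.End A' M) (M₀ : Submodule A' M) :
    Monotone (φ.powKer M₀) := by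
  refine monotone_nat_of_le_succ fun n x hx ↦ ?_
  have := map_powSum_le φ M₀ n (Submodule.mem_map_of_mem hx)
  rw [powKer, Submodule.mem_comap, pow_succ']
  exact this

/-- The successive quotients of `φ.powSum M₀` are quotients of `M₀`. -/
theorem Module.End.nonempty_quotient_powKer_equiv (φ : Module.End A' M) (M₀ : Submodule A' M)
    (n : ℕ) : Nonempty ((M₀ ⧸ φ.powKer M₀ n) ≃ₗ[A']
      (φ.powSum M₀ (n + 1) ⧸ (φ.powSum M₀ n).submoduleOf (φ.powSum M₀ (n + 1)))) := by
  let g : M₀ →ₗ[A'] φ.powSum M₀ (n + 1) := ((φ ^ n) ∘ₗ M₀.subtype).codRestrict _ fun x ↦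
    le_sup_right (a := φ.powSum M₀ n) (Submodule.mem_map_of_mem x.2)
  let q := ((φ.powSum M₀ n).submoduleOf (φ.powSum M₀ (n + 1))).mkQ ∘ₗ g
  have hker : LinearMap.ker q = φ.powKer M₀ n := by
    rw [LinearMap.ker_comp, Submodule.ker_mkQ]; rfl
  have hq : Function.Surjective q := by
    intro y
    obtain ⟨⟨y, hy⟩, rfl⟩ := Submodule.mkQ_surjective _ y
    obtain ⟨a, ha, _, ⟨m, hm, rfl⟩, rfl⟩ := Submodule.mem_sup.mp hy
    refine ⟨⟨m, hm⟩, (Submodule.Quotient.eq _).mpr ?_⟩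
    rw [Submodule.submoduleOf, Submodule.mem_comap]
    change (φ ^ n) m - (a + (φ ^ n) m) ∈ _
    simpa using ha
  exact ⟨(Submodule.quotEquivOfEq _ _ hker.symm).trans (q.quotKerEquivOfSurjective hq)⟩

/-- The filtration `φ.powSum M₀` exhausts `M`, with graded pieces `M₀ ⧸ φ.powKer M₀ n`. The kernels
increase in a Noetherian module, so only finitely many different pieces occur. -/
theorem IsGenericallyFlat.of_end {A : Type u} {A' : Type*} {M : Type v} [CommRing A] [IsDomain A]
    [CommRing A'] [Algebra A A'] [IsNoetherianRing A'] [AddCommGroup M] [Module A M] [Module A' M]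
    [IsScalarTower A A' M] (hA' : HasGenericFlatness.{u, v} A A') (φ : Module.End A' M)
    (M₀ : Submodule A' M) (hM₀ : M₀.FG)
    (h : ∀ N : Submodule A' M, M₀ ≤ N → N.map φ ≤ N → N = ⊤) : IsGenericallyFlat A M := by
  have : Module.Finite A' M₀ := .of_fg hM₀
  have : IsNoetherian A' M₀ := isNoetherian_of_isNoetherianRing_of_finite A' M₀
  obtain ⟨s, hs⟩ := monotone_stabilizes_iff_noetherian.mpr this
    ⟨φ.powKer M₀, φ.powKer_monotone M₀⟩
  choose f hf hfl using fun i ↦ hA' (M₀ ⧸ φ.powKer M₀ i)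
  -- If the product is invertible in `T`, so is each factor; the pieces beyond `s` coincide with the
  -- one at `s`.
  refine ⟨∏ i ∈ Finset.range (s + 1), f i, Finset.prod_ne_zero_iff.mpr fun i _ ↦ hf i,
    fun T _ _ _ hu ↦ ?_⟩
  rw [map_prod, IsUnit.prod_iff] at hu
  have hle : ∀ i ≤ s, Module.Flat A (T ⊗[A] (M₀ ⧸ φ.powKer M₀ i)) := fun i hi ↦
    hfl i T (hu i (by simpa using Nat.lt_succ_of_le hi))
  have hall (i) : Module.Flat A (T ⊗[A] (M₀ ⧸ φ.powKer M₀ i)) := by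
    obtain hi | hi := le_total i s
    · exact hle i hi
    · have : φ.powKer M₀ s = φ.powKer M₀ i := hs i hi
      rw [← this]
      exact hle s le_rfl
  refine Module.Flat.tensorProduct_of_filtration (fun j ↦ (φ.powSum M₀ j).restrictScalars A)
    (fun i j hij ↦ φ.powSum_monotone M₀ hij) (by simp [Module.End.powSum])
    (φ.exists_mem_powSum M₀ h) fun j ↦ ?_
  obtain ⟨e⟩ := φ.nonempty_quotient_powKer_equiv M₀ j
  have := hall j
  exact Module.Flat.of_linearEquiv (((e.restrictScalars A).lTensor T).symm)

end

theorem HasGenericFlatness.polynomial {A : Type u} {A' : Type*} [CommRing A] [IsDomain A]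
    [CommRing A'] [Algebra A A'] [IsNoetherianRing A'] (h : HasGenericFlatness.{u, v} A A') :
    HasGenericFlatness.{u, v} A (Polynomial A') := by
  intro M _ _ _ _ _
  let : Module A' M := Module.compHom M (Polynomial.C : A' →+* Polynomial A')
  have t1 : IsScalarTower A' (Polynomial A') M := ⟨fun a q m ↦ by
    rw [Polynomial.smul_eq_C_mul, mul_smul]; rfl⟩
  have t2 : IsScalarTower A A' M := ⟨fun a b m ↦ by
    change Polynomial.C (a • b) • m = a • (Polynomial.C b • m)
    rw [← Polynomial.smul_C, smul_assoc]⟩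
  obtain ⟨s, hs⟩ := Module.Finite.fg_top (R := Polynomial A') (M := M)
  -- `φ` is multiplication by `X`: an `A'`-submodule stable under it is an `A'[X]`-submodule, hence
  -- everything once it contains the generators.
  refine IsGenericallyFlat.of_end h
    (LinearMap.lsmul (Polynomial A') M Polynomial.X |>.restrictScalars A')
    (Submodule.span A' s) ⟨s, rfl⟩ fun N hN hX ↦ ?_
  let N' : Submodule (Polynomial A') M :=
    { N with
      smul_mem' := fun q m hm ↦ by
        induction q using Polynomial.induction_on' with
        | add p q hp hq => rw [add_smul]; exact N.add_mem hp hq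
        | monomial n a =>
          rw [← Polynomial.C_mul_X_pow_eq_monomial, mul_smul]
          refine N.smul_mem a ?_
          induction n with
          | zero => simpa using hm
          | succ n ih =>
            rw [pow_succ', mul_smul]
            exact hX (Submodule.mem_map_of_mem ih) }
  have : N' = ⊤ := top_le_iff.mp (hs ▸ Submodule.span_le.mpr
    (Submodule.subset_span.trans hN : (s : Set M) ⊆ N))
  ext x
  have hx : x ∈ N' := this ▸ Submodule.mem_top
  exact iff_of_true hx Submodule.mem_top

theorem HasGenericFlatness.of_surjective {A : Type u} {A' A'' : Type*} [CommRing A] [CommRing A']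
    [Algebra A A'] [CommRing A''] [Algebra A A''] (g : A' →ₐ[A] A'') (hg : Function.Surjective g)
    (h : HasGenericFlatness.{u, v} A A') : HasGenericFlatness.{u, v} A A'' := by
  intro M _ _ _ _ _
  let : Module A' M := Module.compHom M (g : A' →+* A'')
  have : IsScalarTower A A' M := ⟨fun a b m ↦ by
    change g (a • b) • m = a • (g b • m)
    rw [map_smul, smul_assoc]⟩
  let : Algebra A' A'' := (g : A' →+* A'').toAlgebra
  have : IsScalarTower A' A'' M := ⟨fun a b m ↦ by
    rw [Algebra.smul_def, mul_smul]; rfl⟩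
  have : Module.Finite A' A'' := .of_surjective (Algebra.linearMap A' A'') hg
  have : Module.Finite A' M := .trans A'' M
  exact h M

theorem HasGenericFlatness.of_finiteType (A : Type u) (A' : Type*) [CommRing A] [IsDomain A]
    [IsNoetherianRing A] [CommRing A'] [Algebra A A'] [Algebra.FiniteType A A'] :
    HasGenericFlatness.{u, v} A A' := by
  have (n : ℕ) : HasGenericFlatness.{u, v} A (MvPolynomial (Fin n) A) := by
    induction n with
    | zero =>
      intro M _ _ _ _ _
      have : Module.Finite A (MvPolynomial (Fin 0) A) :=
        .of_surjective (Algebra.linearMap _ _) (MvPolynomial.C_surjective _)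
      have : Module.Finite A M := .trans (MvPolynomial (Fin 0) A) M
      exact .of_finite A M
    | succ n ih =>
      exact .of_surjective (MvPolynomial.finSuccEquiv A n).symm.toAlgHom
        (MvPolynomial.finSuccEquiv A n).symm.surjective ih.polynomial
  obtain ⟨n, g, hg⟩ := Algebra.FiniteType.iff_quotient_mvPolynomial''.mp ‹Algebra.FiniteType A A'›
  exact .of_surjective g hg (this n)

end GenericFlatness

/-! ### Injections that stay injective under base change -/

section UniversallyInjective

open LinearMap

/-- After tensoring with `T` the cokernel is flat, so injectivity survives tensoring with `N`. As
`N` is a `T`-module, `N → N ⊗[A] T` is split by the action, which brings injectivity back to `f`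
itself. -/
theorem LinearMap.injective_lTensor_of_flat_localization {A M₁ M₂ M₃ : Type*} [CommRing A]
    [AddCommGroup M₁] [AddCommGroup M₂] [AddCommGroup M₃] [Module A M₁] [Module A M₂] [Module A M₃]
    {f : M₁ →ₗ[A] M₂} {g : M₂ →ₗ[A] M₃} (hf : Function.Injective f) (hfg : Function.Exact f g)
    (hg : Function.Surjective g) (T N : Type*) [CommRing T] [Algebra A T] [Module.Flat A T]
    [Module.Flat A (T ⊗[A] M₃)] [AddCommGroup N] [Module A N] [Module T N] [IsScalarTower A T N] :
    Function.Injective (f.lTensor N) := by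
  have h := LinearMap.lTensor_injective_of_exact_of_flat (g.lTensor T)
    (lTensor_surjective T hg) (f.lTensor T)
    (Module.Flat.lTensor_preserves_injective_linearMap f hf)
    (_root_.lTensor_exact T hfg hg) N
  let i₁ : N ⊗[A] M₁ →ₗ[A] N ⊗[A] (T ⊗[A] M₁) := (TensorProduct.mk A T M₁ 1).lTensor N
  let i₂ : N ⊗[A] M₂ →ₗ[A] N ⊗[A] (T ⊗[A] M₂) := (TensorProduct.mk A T M₂ 1).lTensor N
  let act : N ⊗[A] T →ₗ[A] N := TensorProduct.lift ((LinearMap.lsmul T N).flip.restrictScalars₁₂ A A)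
  have hi : Function.LeftInverse
      (act.rTensor M₁ ∘ₗ (TensorProduct.assoc A N T M₁).symm.toLinearMap) i₁ := by
    intro x
    induction x with
    | zero => simp
    | tmul n m => simp [i₁, act]
    | add x y hx hy => rw [map_add, map_add, hx, hy]
  have hcomm : (f.lTensor T).lTensor N ∘ₗ i₁ = i₂ ∘ₗ f.lTensor N := by
    ext; simp [i₁, i₂]
  refine Function.Injective.of_comp (f := i₂) ?_
  rw [← LinearMap.coe_comp, ← hcomm]
  exact h.comp hi.injective

end UniversallyInjective

/-! ### Relative Frobenius as a linear map over `F_* A` -/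

namespace FrobeniusPushforward

variable (p : ℕ) (A R : Type*) [CommRing A] [CommRing R] [Algebra A R]
  [ExpChar A p] [ExpChar R p]

/-- `F_* R` as an algebra over `F_* A`. -/
@[reducible]
def algebraPushforward : Algebra (FrobeniusPushforward p A) (FrobeniusPushforward p R) :=
  inferInstanceAs (Algebra A R)

attribute [local instance] algebraPushforward

instance isScalarTower_pushforward :
    IsScalarTower A (FrobeniusPushforward p A) (FrobeniusPushforward p R) :=
  .of_algebraMap_eq fun a ↦ ((map p A R).commutes a).symm

theorem pushforward_smul (a : FrobeniusPushforward p A) (r : FrobeniusPushforward p R) :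
    a • r = map p A R a * r :=
  Algebra.smul_def a r

/-- The relative Frobenius as an `F_* A`-linear map. -/
noncomputable def relativeFrobeniusLinear :
    FrobeniusPushforward p A ⊗[A] R →ₗ[FrobeniusPushforward p A] FrobeniusPushforward p R :=
  { (relativeFrobenius p A R : FrobeniusPushforward p A ⊗[A] R →+ FrobeniusPushforward p R) with
    map_smul' := fun b x ↦ by
      change relativeFrobenius p A R (b • x) = b • relativeFrobenius p A R x
      rw [pushforward_smul]
      induction x with
      | zero => simp
      | tmul a r =>
        rw [TensorProduct.smul_tmul', smul_eq_mul, relativeFrobenius,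
          Algebra.TensorProduct.productMap_apply_tmul, Algebra.TensorProduct.productMap_apply_tmul,
          map_mul, mul_assoc]
      | add x y hx hy => rw [smul_add, map_add, map_add, mul_add, hx, hy] }

theorem relativeFrobeniusLinear_apply (x : FrobeniusPushforward p A ⊗[A] R) :
    relativeFrobeniusLinear p A R x = relativeFrobenius p A R x := rfl

end FrobeniusPushforward

open FrobeniusPushforward

attribute [local instance] algebraPushforward

/-! ### Injectivity of the relative Frobenius and reducedness over perfect fields -/

section Reduced

variable (p : ℕ) [Fact p.Prime] (A R L : Type*) [CommRing A] [CommRing R] [Algebra A R] [Field L]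
  [Algebra A L] [ExpChar A p] [ExpChar R p] [ExpChar L p] [PerfectRing L p]

/-- The Frobenius of a perfect field as an `A`-linear equivalence `L ≃ F_* L`. -/
noncomputable def frobLinearEquiv : L ≃ₗ[A] FrobeniusPushforward p L :=
  .ofBijective (frob p A L).toLinearMap (bijective_frobenius L p)

/-- If the relative Frobenius stays injective after tensoring with `F_* L`, where `L` is a perfect
field, then `L ⊗[A] R` is reduced. -/
theorem isReduced_tensorProduct_of_injective_lTensor
    (h : Function.Injective
      ((relativeFrobeniusLinear p A R).lTensor (FrobeniusPushforward p L))) :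
    IsReduced (L ⊗[A] R) := by
  cases subsingleton_or_nontrivial (L ⊗[A] R) with
  | inl _ => infer_instance
  | inr _ =>
  have : ExpChar (L ⊗[A] R) p :=
    expChar_of_injective_ringHom (algebraMap L (L ⊗[A] R)).injective p
  rw [isReduced_iff_pow_one_lt p (Fact.out : p.Prime).one_lt]
  intro x hx
  -- `ψ` sends `l ⊗ r` to `l ^ p ⊗ (1 ⊗ r)`; it is bijective because `L` is perfect.
  let ψ : L ⊗[A] R ≃+
      FrobeniusPushforward p L ⊗[FrobeniusPushforward p A] (FrobeniusPushforward p A ⊗[A] R) :=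
    ((frobLinearEquiv p A L).rTensor R).toAddEquiv.trans
      (TensorProduct.AlgebraTensorModule.cancelBaseChange A (FrobeniusPushforward p A)
        (FrobeniusPushforward p A) (FrobeniusPushforward p L) R).symm.toAddEquiv
  -- `θ` is the identity on underlying rings, `l ⊗ r ↦ l ⊗ r`.
  let θ : L ⊗[A] R →+ FrobeniusPushforward p L ⊗[FrobeniusPushforward p A]
      FrobeniusPushforward p R :=
    TensorProduct.liftAddHom
      (AddMonoidHom.mk' (fun l ↦ (TensorProduct.mk (FrobeniusPushforward p A)
          (FrobeniusPushforward p L) (FrobeniusPushforward p R) (of p L l)).toAddMonoidHom.comp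
          (of p R : R →+ FrobeniusPushforward p R))
        fun l l' ↦ by ext r; exact TensorProduct.add_tmul _ _ _)
      fun a l r ↦ by
        change of p L (a • l) ⊗ₜ[FrobeniusPushforward p A] of p R r = of p L l ⊗ₜ of p R (a • r)
        have h₁ : of p L (a • l) = of p A a • of p L l := rfl
        have h₂ : of p R (a • r) = of p A a • of p R r := rfl
        rw [h₁, h₂, TensorProduct.smul_tmul]
  have key : ((relativeFrobeniusLinear p A R).lTensor (FrobeniusPushforward p L)) (ψ x) =
      θ (x ^ p) := by
    clear hx
    induction x with
    | zero => simp [(Fact.out : p.Prime).ne_zero]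
    | tmul l r =>
      have h₁ : ψ (l ⊗ₜ r) = of p L (l ^ p) ⊗ₜ (1 ⊗ₜ r) := rfl
      have h₂ : θ ((l ^ p) ⊗ₜ (r ^ p)) = of p L (l ^ p) ⊗ₜ of p R (r ^ p) := rfl
      have h₃ : relativeFrobeniusLinear p A R (1 ⊗ₜ r) = of p R (r ^ p) := by
        rw [relativeFrobeniusLinear_apply, ← map_one (of p A), relativeFrobenius_tmul, map_one,
          one_mul]
      rw [Algebra.TensorProduct.tmul_pow, h₁, h₂, LinearMap.lTensor_tmul, h₃]
    | add x y hx hy => rw [map_add, map_add, add_pow_expChar, map_add, hx, hy]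
  rw [hx, map_zero] at key
  exact ψ.map_eq_zero_iff.mp ((injective_iff_map_eq_zero _).mp h _ key)

variable {L} in
/-- If `R` is flat over `A ⊆ L` and `L ⊗[A] R` is reduced, then the relative Frobenius of `R` over
`A` is injective. -/
theorem injective_relativeFrobenius_of_isReduced [Module.Flat A R] [FaithfulSMul A L]
    [IsReduced (L ⊗[A] R)] : Function.Injective (relativeFrobenius p A R) := by
  -- `ι` is `a ↦ a ^ (1 / p)`, which is `A`-linear for the Frobenius structure on `F_* A`.
  let ι : FrobeniusPushforward p A →ₗ[A] L :=
    (frobLinearEquiv p A L).symm.toLinearMap ∘ₗ (map p A L).toLinearMap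
  have hι : Function.Injective ι := (frobLinearEquiv p A L).symm.injective.comp
    (FaithfulSMul.algebraMap_injective A L)
  have hιpow (a : A) : ι (of p A a) ^ p = algebraMap A L a :=
    (frobLinearEquiv p A L).apply_symm_apply (of p L (algebraMap A L a))
  have hg : Function.Injective (ι.rTensor R) :=
    Module.Flat.rTensor_preserves_injective_linearMap ι hι
  rw [injective_iff_map_eq_zero]
  intro x hx
  apply hg
  cases subsingleton_or_nontrivial (L ⊗[A] R) with
  | inl _ => exact Subsingleton.elim _ _
  | inr _ =>
  have : ExpChar (L ⊗[A] R) p :=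
    expChar_of_injective_ringHom (algebraMap L (L ⊗[A] R)).injective p
  have key : (ι.rTensor R x) ^ p = Algebra.TensorProduct.includeRight
      ((of p R).symm (relativeFrobenius p A R x)) := by
    clear hx
    induction x with
    | zero => simp [(Fact.out : p.Prime).ne_zero]
    | tmul a r =>
      obtain ⟨a, rfl⟩ := (of p A).surjective a
      rw [relativeFrobenius_tmul, RingEquiv.symm_apply_apply, LinearMap.rTensor_tmul,
        Algebra.TensorProduct.tmul_pow, hιpow, Algebra.TensorProduct.includeRight_apply,
        ← Algebra.smul_def, TensorProduct.tmul_smul, TensorProduct.smul_tmul',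
        Algebra.smul_def, mul_one]
    | add x y hx hy => rw [map_add, add_pow_expChar, hx, hy, map_add, map_add, map_add]
  rw [hx, map_zero, map_zero] at key
  rw [map_zero]
  exact pow_eq_zero_iff (Fact.out : p.Prime).ne_zero |>.mp key

end Reduced

/-! ### The flat case: (1) ⇔ (2) -/

section GeometricallyReduced

theorem isReduced_iff_of_ringEquiv {S T : Type*} [CommRing S] [CommRing T] (e : S ≃+* T) :
    IsReduced S ↔ IsReduced T :=
  ⟨fun _ ↦ isReduced_of_injective e.symm e.symm.injective,
    fun _ ↦ isReduced_of_injective e e.injective⟩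

theorem isGeometricallyReduced_tensorProduct_iff (A R κ : Type*) [CommRing A] [CommRing R]
    [Algebra A R] [Field κ] [Algebra A κ] :
    Algebra.IsGeometricallyReduced κ (κ ⊗[A] R) ↔ IsReduced (AlgebraicClosure κ ⊗[A] R) := by
  rw [Algebra.isGeometricallyReduced_field_iff]
  exact isReduced_iff_of_ringEquiv (Algebra.TensorProduct.cancelBaseChange A κ κ
    (AlgebraicClosure κ) R).toRingEquiv

variable (p : ℕ) [Fact p.Prime] (A R : Type*) [CommRing A] [CommRing R] [Algebra A R] [IsDomain A]
  [CharP A p] [CharP R p]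

theorem injective_relativeFrobenius_iff (K : Type*) [Module.Flat A R] [Field K] [Algebra A K]
    [IsFractionRing A K] :
    Function.Injective (relativeFrobenius p A R) ↔
      Algebra.IsGeometricallyReduced K (K ⊗[A] R) := by
  rw [isGeometricallyReduced_tensorProduct_iff]
  have : FaithfulSMul A K := (faithfulSMul_iff_algebraMap_injective A K).mpr
    (IsFractionRing.injective A K)
  have : FaithfulSMul A (AlgebraicClosure K) := .trans A K _
  have : CharP (AlgebraicClosure K) p := .of_ringHom_of_ne_zero
    (algebraMap A (AlgebraicClosure K)) p (Fact.out : p.Prime).ne_zero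
  have : PerfectRing (AlgebraicClosure K) p := PerfectField.toPerfectRing p
  refine ⟨fun h ↦ isReduced_tensorProduct_of_injective_lTensor p A R (AlgebraicClosure K) ?_,
    fun _ ↦ injective_relativeFrobenius_of_isReduced p A R (L := AlgebraicClosure K)⟩
  have hK : Module.Flat A K := IsLocalization.flat K (nonZeroDivisors A)
  have hL : Module.Flat A (AlgebraicClosure K) := .trans A K _
  have : Module.Flat (FrobeniusPushforward p A) (FrobeniusPushforward p (AlgebraicClosure K)) := hL
  exact Module.Flat.lTensor_preserves_injective_linearMap (relativeFrobeniusLinear p A R) h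

end GeometricallyReduced

/-! ### Spreading out reducedness of the geometric generic fiber -/

section Generic

/-- The power condition makes `S` integral over `D`; being of finite type it is then finite, so the
cokernel is a finite `D`-module and generic flatness applies. -/
theorem IsGenericallyFlat.quotient_range {B : Type u} {D : Type*} {S : Type v} [CommRing B]
    [IsDomain B] [IsNoetherianRing B] [CommRing D] [Algebra B D] [Algebra.FiniteType B D]
    [CommRing S] [Algebra B S] [Algebra.FiniteType B S] (φ : D →ₐ[B] S)
    {n : ℕ} (hn : 0 < n) (hφ : ∀ s, s ^ n ∈ φ.range) :
    IsGenericallyFlat B (S ⧸ LinearMap.range φ.toLinearMap) := by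
  let : Algebra D S := φ.toRingHom.toAlgebra
  have : IsScalarTower B D S := .of_algebraMap_eq fun b ↦ (φ.commutes b).symm
  have : Algebra.FiniteType D S := .of_restrictScalars_finiteType B D S
  have : Algebra.IsIntegral D S := ⟨fun s ↦ by
    obtain ⟨d, hd⟩ := hφ s
    exact .of_pow hn (hd ▸ isIntegral_algebraMap (R := D) (A := S) (x := d))⟩
  have : Module.Finite D S := Algebra.IsIntegral.finite
  exact HasGenericFlatness.of_finiteType B D (S ⧸ LinearMap.range (Algebra.linearMap D S))

theorem isGenericallyFlat_quotient_range_relativeFrobenius (p : ℕ) [Fact p.Prime] (A : Type u)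
    (R : Type v) [CommRing A] [CommRing R] [Algebra A R] [IsDomain A] [IsNoetherianRing A]
    [ExpChar A p] [ExpChar R p] [Algebra.FiniteType A R] :
    IsGenericallyFlat (FrobeniusPushforward p A)
      (FrobeniusPushforward p R ⧸ LinearMap.range (relativeFrobeniusLinear p A R)) := by
  have : IsDomain (FrobeniusPushforward p A) := inferInstanceAs (IsDomain A)
  have : IsNoetherianRing (FrobeniusPushforward p A) := inferInstanceAs (IsNoetherianRing A)
  have : Algebra.FiniteType (FrobeniusPushforward p A) (FrobeniusPushforward p R) :=
    ‹Algebra.FiniteType A R›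
  refine IsGenericallyFlat.quotient_range (AlgHom.ofLinearMap (relativeFrobeniusLinear p A R)
    (map_one (relativeFrobenius p A R)) (map_mul (relativeFrobenius p A R)))
    (Fact.out : p.Prime).pos fun s ↦ ?_
  obtain ⟨r, rfl⟩ := (of p R).surjective s
  refine ⟨1 ⊗ₜ r, ?_⟩
  change relativeFrobenius p A R (1 ⊗ₜ r) = _
  rw [← map_one (of p A), relativeFrobenius_tmul, map_one, one_mul, map_pow]

theorem exists_isReduced_tensorProduct_of_flat (p : ℕ) [Fact p.Prime] (A : Type u) (R Ω : Type*)
    [CommRing A] [CommRing R] [Algebra A R] [IsDomain A] [IsNoetherianRing A] [CharP A p]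
    [CharP R p] [Module.Flat A R] [Algebra.FiniteType A R]
    [Field Ω] [IsAlgClosed Ω] [Algebra A Ω] [FaithfulSMul A Ω] [IsReduced (Ω ⊗[A] R)] :
    ∃ g : A, g ≠ 0 ∧ ∀ (L : Type v) [Field L] [IsAlgClosed L] [Algebra A L],
      algebraMap A L g ≠ 0 → IsReduced (L ⊗[A] R) := by
  have hp := (Fact.out : p.Prime).ne_zero
  have : CharP Ω p := .of_ringHom_of_ne_zero (algebraMap A Ω) p hp
  have : PerfectRing Ω p := PerfectField.toPerfectRing p
  have hinj : Function.Injective (relativeFrobenius p A R) :=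
    injective_relativeFrobenius_of_isReduced p A R (L := Ω)
  obtain ⟨g, hg, H⟩ := isGenericallyFlat_quotient_range_relativeFrobenius p A R
  refine ⟨(of p A).symm g, by simpa using hg, fun L _ _ _ hgL ↦ ?_⟩
  have : CharP L p := .of_ringHom_of_ne_zero (algebraMap A L) p hp
  have : PerfectRing L p := PerfectField.toPerfectRing p
  let T := Localization.Away g
  have : Module.Flat (FrobeniusPushforward p A) T := IsLocalization.flat T (.powers g)
  have := H T (IsLocalization.Away.algebraMap_isUnit g)
  have hu : IsUnit (algebraMap (FrobeniusPushforward p A) (FrobeniusPushforward p L) g) :=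
    (isUnit_iff_ne_zero.mpr hgL).map (of p L)
  -- As `g` is nonzero in `L`, `F_* L` is an algebra over `(F_* A)_g`, where the cokernel is flat.
  let : Algebra T (FrobeniusPushforward p L) :=
    (IsLocalization.Away.lift (S := T) g hu).toAlgebra
  have : IsScalarTower (FrobeniusPushforward p A) T (FrobeniusPushforward p L) :=
    .of_algebraMap_eq fun a ↦ (IsLocalization.Away.lift_eq (S := T) g hu a).symm
  exact isReduced_tensorProduct_of_injective_lTensor p A R L <|
    LinearMap.injective_lTensor_of_flat_localization (f := relativeFrobeniusLinear p A R) hinj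
      (LinearMap.exact_map_mkQ_range _) (Submodule.mkQ_surjective _) T (FrobeniusPushforward p L)

/-- For `L` over a localization `T` of `A`, `L ⊗[A] (T ⊗[A] R)` is `L ⊗[A] R`. -/
noncomputable def tensorTensorLocalizationEquiv {A R T L : Type*} [CommRing A] [CommRing R]
    [Algebra A R] [CommRing T] [CommRing L] [Algebra A T] [Algebra A L] [Algebra T L] [IsScalarTower A T L]
    (S : Submonoid A) [IsLocalization S T] : L ⊗[A] (T ⊗[A] R) ≃+* L ⊗[A] R :=
  (IsLocalization.algebraTensorEquiv S T L (T ⊗[A] R)).symm.toRingEquiv.trans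
    (Algebra.TensorProduct.cancelBaseChange A T T L R).toRingEquiv

/-- For `L` over a localization `T` of `A` and the corresponding localization `R'` of `R`,
`L ⊗[T] R'` is `L ⊗[A] R`. -/
noncomputable def tensorLocalizationEquiv {A R T R' L : Type*} [CommRing A] [CommRing R]
    [Algebra A R] [CommRing T] [CommRing R'] [Algebra R R'] [Algebra A R'] [IsScalarTower A R R']
    [Algebra T R']
    [CommRing L] [Algebra A T] [Algebra A L] [Algebra T L] [IsScalarTower A T L]
    [IsScalarTower A T R']
    (S : Submonoid A) [IsLocalization S T] [IsLocalization (Algebra.algebraMapSubmonoid R S) R'] :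
    L ⊗[T] R' ≃+* L ⊗[A] R :=
  have : Algebra.IsPushout A R T R' := Algebra.isPushout_of_isLocalization S T R R'
  have : Algebra.IsPushout A T R R' := .symm inferInstance
  (Algebra.TensorProduct.congr (AlgEquiv.refl (R := T) (A₁ := L))
    (Algebra.IsPushout.equiv A T R R').symm).toRingEquiv.trans
    (Algebra.TensorProduct.cancelBaseChange A T T L R).toRingEquiv

end Generic

theorem faithfulSMul_algebraicClosure (A K : Type*) [CommRing A] [Field K] [Algebra A K]
    [FaithfulSMul A K] : FaithfulSMul A (AlgebraicClosure K) := .trans A K _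

/-! ### Passing between `A_f → R_f` and `A → R` -/

section Away

variable {A R : Type*} [CommRing A] [CommRing R] [Algebra A R] (f : A)

theorem isScalarTower_and_isLocalization_awayMap :
    letI := (Localization.awayMap (algebraMap A R) f).toAlgebra
    IsScalarTower A (Localization.Away f) (Localization.Away (algebraMap A R f)) ∧
    IsLocalization (Algebra.algebraMapSubmonoid R (.powers f))
      (Localization.Away (algebraMap A R f)) := by
  let := (Localization.awayMap (algebraMap A R) f).toAlgebra
  refine ⟨.of_algebraMap_eq fun a ↦ ?_, ?_⟩
  · change _ = Localization.awayMap (algebraMap A R) f _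
    rw [Localization.awayMap, IsLocalization.Away.map, IsLocalization.map_eq]
    exact IsScalarTower.algebraMap_apply A R _ a
  · rw [Algebra.algebraMapSubmonoid, Submonoid.map_powers]
    exact inferInstanceAs (IsLocalization.Away (algebraMap A R f) _)

theorem hasGeometricallyReducedFibers_awayMap_iff :
    HasGeometricallyReducedFibers (Localization.awayMap (algebraMap A R) f) ↔
      ∀ (q : Ideal (Localization.Away f)) [q.IsPrime],
        IsReduced (AlgebraicClosure q.ResidueField ⊗[A] R) := by
  let := (Localization.awayMap (algebraMap A R) f).toAlgebra
  obtain ⟨_, _⟩ := isScalarTower_and_isLocalization_awayMap (R := R) f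
  refine forall₂_congr fun q _ ↦ ?_
  refine (isGeometricallyReduced_tensorProduct_iff (Localization.Away f)
    (Localization.Away (algebraMap A R f)) q.ResidueField).trans ?_
  exact isReduced_iff_of_ringEquiv (tensorLocalizationEquiv (.powers f))

theorem flat_awayMap_iff :
    (Localization.awayMap (algebraMap A R) f).Flat ↔
      Module.Flat A (Localization.Away f ⊗[A] R) := by
  let := (Localization.awayMap (algebraMap A R) f).toAlgebra
  obtain ⟨_, _⟩ := isScalarTower_and_isLocalization_awayMap (R := R) f
  have : Algebra.IsPushout A R (Localization.Away f) (Localization.Away (algebraMap A R f)) :=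
    Algebra.isPushout_of_isLocalization (.powers f) _ _ _
  have : Algebra.IsPushout A (Localization.Away f) R (Localization.Away (algebraMap A R f)) :=
    .symm inferInstance
  rw [← Module.flat_iff_of_isLocalization (Localization.Away f) (.powers f)]
  exact Module.Flat.equiv_iff (Algebra.IsPushout.equiv A (Localization.Away f) R
    (Localization.Away (algebraMap A R f))).toLinearEquiv.symm

variable (R) in
theorem isReduced_tensorProduct_away_iff (L : Type*) [Field L] [Algebra A L]
    (hL : algebraMap A L f ≠ 0) :
    IsReduced (L ⊗[A] (Localization.Away f ⊗[A] R)) ↔ IsReduced (L ⊗[A] R) := by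
  let : Algebra (Localization.Away f) L := (IsLocalization.Away.lift f hL.isUnit).toAlgebra
  have : IsScalarTower A (Localization.Away f) L := .of_algebraMap_eq fun a ↦
    (IsLocalization.Away.lift_eq f hL.isUnit a).symm
  exact isReduced_iff_of_ringEquiv (tensorTensorLocalizationEquiv (.powers f))

end Away

/-! ### The finite type case: (2) ⇔ (3) -/

section

variable (A : Type u) (R K : Type*) [CommRing A] [CommRing R] [Algebra A R]
  [Field K] [Algebra A K] [IsFractionRing A K]

/-- `L` contains an algebraic closure of `K`, and tensoring that inclusion over `K` keeps it
injective. -/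
theorem isGeometricallyReduced_of_isReduced_tensorProduct (L : Type*) [Field L] [IsAlgClosed L]
    [Algebra A L] [FaithfulSMul A L] [IsReduced (L ⊗[A] R)] :
    Algebra.IsGeometricallyReduced K (K ⊗[A] R) := by
  let : Algebra K L := (IsFractionRing.lift (K := K)
    (FaithfulSMul.algebraMap_injective A L)).toAlgebra
  have : IsScalarTower A K L := .of_algebraMap_eq fun a ↦
    (IsFractionRing.lift_algebraMap (FaithfulSMul.algebraMap_injective A L) a).symm
  have : IsReduced (L ⊗[K] (K ⊗[A] R)) := isReduced_of_injective
    (Algebra.TensorProduct.cancelBaseChange A K K L R)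
    (Algebra.TensorProduct.cancelBaseChange A K K L R).injective
  rw [Algebra.isGeometricallyReduced_field_iff]
  let i : AlgebraicClosure K →ₐ[K] L := IsAlgClosed.lift
  exact isReduced_of_injective (Algebra.TensorProduct.map i (AlgHom.id K (K ⊗[A] R)))
    (Module.Flat.rTensor_preserves_injective_linearMap i.toLinearMap i.injective)

variable [IsDomain A]

theorem isGeometricallyReduced_of_fibers {f : A} (hf : f ≠ 0)
    (h : HasGeometricallyReducedFibers (Localization.awayMap (algebraMap A R) f)) :
    Algebra.IsGeometricallyReduced K (K ⊗[A] R) := by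
  have hle : Submonoid.powers f ≤ nonZeroDivisors A :=
    powers_le_nonZeroDivisors_of_noZeroDivisors hf
  have : IsDomain (Localization.Away f) := IsLocalization.isDomain_localization hle
  have := (hasGeometricallyReducedFibers_awayMap_iff f).mp h ⊥
  let κ := (⊥ : Ideal (Localization.Away f)).ResidueField
  have : FaithfulSMul A κ := by
    rw [faithfulSMul_iff_algebraMap_injective,
      IsScalarTower.algebraMap_eq A (Localization.Away f) κ, RingHom.coe_comp]
    refine Function.Injective.comp ?_ (IsLocalization.injective (Localization.Away f) hle)
    exact (injective_iff_map_eq_zero _).mpr fun x hx ↦ Ideal.algebraMap_residueField_eq_zero.mp hx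
  have : FaithfulSMul A (AlgebraicClosure κ) := faithfulSMul_algebraicClosure A κ
  exact isGeometricallyReduced_of_isReduced_tensorProduct A R K (AlgebraicClosure κ)

variable [IsNoetherianRing A] [Algebra.FiniteType A R]

theorem exists_flat_hasGeometricallyReducedFibers (p : ℕ) [Fact p.Prime] [CharP A p]
    [h : Algebra.IsGeometricallyReduced K (K ⊗[A] R)] :
    ∃ f : A, f ≠ 0 ∧ (Localization.awayMap (algebraMap A R) f).Flat ∧
      HasGeometricallyReducedFibers (Localization.awayMap (algebraMap A R) f) := by
  obtain ⟨f, hf, hflat⟩ := HasGenericFlatness.of_finiteType A R R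
  let T := Localization.Away f
  have : Module.Flat A T := IsLocalization.flat T (.powers f)
  have := hflat T (IsLocalization.Away.algebraMap_isUnit f)
  obtain ⟨g, hg, H⟩ : ∃ g : A, g ≠ 0 ∧ ∀ (L : Type u) [Field L] [IsAlgClosed L] [Algebra A L],
      algebraMap A L g ≠ 0 → IsReduced (L ⊗[A] (T ⊗[A] R)) := by
    -- The zero ring does not have characteristic `p`, so it is treated apart.
    cases subsingleton_or_nontrivial (T ⊗[A] R) with
    | inl _ => exact ⟨1, one_ne_zero, fun L _ _ _ _ ↦ inferInstance⟩
    | inr _ =>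
    have : CharP (T ⊗[A] R) p := .of_ringHom_of_ne_zero (algebraMap A (T ⊗[A] R)) p
      (Fact.out : p.Prime).ne_zero
    have : Algebra.FiniteType A T := IsLocalization.finiteType_of_monoid_fg (.powers f) T
    have : Algebra.FiniteType A (T ⊗[A] R) :=
      .trans (S := T) inferInstance inferInstance
    have : FaithfulSMul A K := (faithfulSMul_iff_algebraMap_injective A K).mpr
      (IsFractionRing.injective A K)
    have : FaithfulSMul A (AlgebraicClosure K) := faithfulSMul_algebraicClosure A K
    have : IsReduced (AlgebraicClosure K ⊗[A] (T ⊗[A] R)) :=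
      (isReduced_tensorProduct_away_iff R f _
        ((map_ne_zero_iff _ (FaithfulSMul.algebraMap_injective _ _)).mpr hf)).mpr
        ((isGeometricallyReduced_tensorProduct_iff A R K).mp h)
    exact exists_isReduced_tensorProduct_of_flat p A (T ⊗[A] R) (AlgebraicClosure K)
  -- Inverting `f` gives flatness; inverting `g` as well gives reducedness of the geometric fibers.
  refine ⟨f * g, mul_ne_zero hf hg, ?_, ?_⟩
  · rw [flat_awayMap_iff]
    have : Module.Flat A (Localization.Away (f * g)) := IsLocalization.flat _ (.powers (f * g))
    have hu := IsLocalization.Away.algebraMap_isUnit (S := Localization.Away (f * g)) (f * g)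
    rw [map_mul] at hu
    exact hflat _ (isUnit_of_mul_isUnit_left hu)
  · rw [hasGeometricallyReducedFibers_awayMap_iff]
    intro q _
    have hu := (IsLocalization.Away.algebraMap_isUnit (S := Localization.Away (f * g)) (f * g)).map
      (algebraMap (Localization.Away (f * g)) (AlgebraicClosure q.ResidueField))
    rw [← IsScalarTower.algebraMap_apply, map_mul, isUnit_iff_ne_zero, mul_ne_zero_iff] at hu
    exact (isReduced_tensorProduct_away_iff R f _ hu.1).mp (H _ hu.2)

end

theorem mainTheorem9 (p : ℕ) [Fact p.Prime]
    (A R K : Type*) [CommRing A] [CommRing R] [Algebra A R]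
    [IsNoetherianRing A] [IsNoetherianRing R] [CharP A p] [CharP R p]
    [IsDomain A] [Field K] [Algebra A K] [IsFractionRing A K] :
    (Module.Flat A R →
      (Function.Injective (relativeFrobenius p A R) ↔
        Algebra.IsGeometricallyReduced K (K ⊗[A] R))) ∧
    (Algebra.FiniteType A R →
      (Algebra.IsGeometricallyReduced K (K ⊗[A] R) ↔
        ∃ f : A, f ≠ 0 ∧
          (Localization.awayMap (algebraMap A R) f).Flat ∧
          HasGeometricallyReducedFibers (Localization.awayMap (algebraMap A R) f))) :=
  ⟨fun _ ↦ injective_relativeFrobenius_iff p A R K,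
    fun _ ↦ ⟨fun _ ↦ exists_flat_hasGeometricallyReducedFibers A R K p,
      fun ⟨_, hf, _, h⟩ ↦ isGeometricallyReduced_of_fibers A R K hf h⟩⟩
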